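/- Let $d\geq 1$ and $N\geq 3$ be integers, and write $N=p_1^{a_1}p_2^{a_2}\cdots p_s^{a_s}$ with primes $p_1<p_2<\dots<p_s$ and exponents $a_j\geq 1$. Let $T^d_N$ be the $d$-dimensional discrete torus, i.e. the Cayley graph of the group $(\mathbb{Z}/N\mathbb{Z})^d$ with respect to the generating set $\{\pm e_1,\dots,\pm e_d\}$, where $e_i$ is the element with $1$ in the $i$-th coordinate and $0$ in all others. By an eigenvalue of $T^d_N$ we mean an eigenvalue of its adjacency matrix. Let $\mathbb{N}=\{0,1,2,\dots\}$. If $s=1$, we set $p_2=\infty$. (i) If $2\nmid N$, then $0$ is an eigenvalue of $T^d_N$ if and only if $2d\in\mathbb{N}p_1+\cdots+\mathbb{N}p_s$. (ii) If $2\mid N$ and $d$ is even, then $0$ is an eigenvalue of $T^d_N$. (iii) If $2\mid N$, $d$ is odd and $p_2\leq d$, then $0$ is an eigenvalue of $T^d_N$. (iv) If $2\mid N$, $d$ is odd and $p_2>d$, then $0$ is an eigenvalue of $T^d_N$ if and only if $4\mid N$. -/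

import Mathlib

/-- The `d`-dimensional discrete torus `T^d_N`: the Cayley graph of the additive group
`(ℤ/Nℤ)^d` with respect to the generating set `{±e_1, …, ±e_d}`, where `e_i` is the
`i`-th canonical basis vector. -/
def discreteTorus (d N : ℕ) : SimpleGraph (Fin d → ZMod N) :=
  SimpleGraph.addCayley {g | ∃ i : Fin d, g = Pi.single i 1 ∨ g = -Pi.single i 1}

open Classical in
/-- `μ` is an eigenvalue of the finite graph `G`, i.e. an eigenvalue of its (real) adjacency
matrix. -/
def IsGraphEigenvalue {V : Type*} [Fintype V] (G : SimpleGraph V) (μ : ℝ) : Prop :=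
  Module.End.HasEigenvalue (Matrix.toLin' (G.adjMatrix ℝ)) μ

/-!
The characters of `(ℤ/Nℤ)^d` diagonalise the adjacency matrix, so the eigenvalues of `T^d_N` are the
sums `∑ (z_i + z_i⁻¹)` over `d`-tuples of `N`-th roots of unity, and `0` is an eigenvalue exactly
when some such sum vanishes. The constructions use halves of regular polygons: for odd `p ∣ N`, one
root from each pair `{z, z⁻¹}` of non-trivial `p`-th roots of unity gives `∑ (z + z⁻¹) = -1`.

The obstructions come from the theorem of Lam and Leung that the length of a vanishing sum of
`N`-th roots of unity is a combination of the prime factors of `N`. For its induction on `N = p m`,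
with `p` the largest prime factor, the roots are split into `p` columns according to their cosets
modulo the `m`-th roots of unity. The degree of the cyclotomic extension shows that all columns sum
to zero if `p ∣ m`, and that all columns have the same sum otherwise. In the second case the columns
are compared by a rigidity property, proved by the same induction: of two multisets of roots of
unity with equal sums, the first one being short, the second contains the first or is much longer.

When `N = 2 M` with `M` odd and `d` is odd, replacing `z` by `-z` where `z ^ M = -1` turns a
vanishing sum into two multisets of `M`-th roots of unity with equal sums and different even sizes,
which rigidity forbids if all prime factors of `M` exceed `d`.
-/

section Rigidity

open Multiset

/-- Rigidity of the relations between elements of `R`, the induction hypothesis behind the theorem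
of Lam and Leung: if `s` and `t` are multisets in `R` with the same sum and `s` has fewer than `q`
elements, then `t` contains `s` or has at least `(q - |s|) n` elements. -/
def IsRigid {A : Type*} [AddCommMonoid A] (R : Set A) (q n : ℕ) : Prop :=
  ∀ s t : Multiset A, (∀ z ∈ s, z ∈ R) → (∀ z ∈ t, z ∈ R) → s.sum = t.sum → card s < q →
    s ≤ t ∨ (q - card s) * n ≤ card t

/-- The numbers `k` such that some `k` elements of `R`, repetitions allowed, sum to zero. For the
`N`-th roots of unity this is the set `W(N)` of Lam and Leung. -/
def vanishingLengths {A : Type*} [AddCommMonoid A] (R : Set A) : AddSubmonoid ℕ where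
  carrier := {k | ∃ s : Multiset A, (∀ z ∈ s, z ∈ R) ∧ s.sum = 0 ∧ card s = k}
  zero_mem' := ⟨0, by simp⟩
  add_mem' := by
    rintro _ _ ⟨s, hs, hs0, rfl⟩ ⟨t, ht, ht0, rfl⟩
    refine ⟨s + t, fun z hz => ?_, by rw [sum_add, hs0, ht0, add_zero], card_add s t⟩
    exact (mem_add.1 hz).elim (hs z) (ht z)

theorem card_mem_vanishingLengths {A : Type*} [AddCommMonoid A] {R : Set A} {s : Multiset A}
    (hs : ∀ z ∈ s, z ∈ R) (hs0 : s.sum = 0) : card s ∈ vanishingLengths R :=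
  ⟨s, hs, hs0, rfl⟩

theorem mul_le_add_mul_of_tsub_mul_le {a b n u w z : ℕ} (hab : a + b ≤ n) (hz : n ≤ z + a)
    (hu : (a + b - w) * n ≤ u) : b * n ≤ u + z * w := by
  obtain h | h := le_total (a + b) w
  · calc b * n ≤ (n - a) * (a + b) := by
          obtain ⟨c, rfl⟩ := Nat.exists_eq_add_of_le hab
          rw [show a + b + c - a = b + c by omega]
          nlinarith [Nat.zero_le (c * a)]
      _ ≤ z * w := Nat.mul_le_mul (by omega) h
      _ ≤ u + z * w := Nat.le_add_left _ _
  · obtain ⟨c, hc⟩ := Nat.exists_eq_add_of_le h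
    rw [hc, Nat.add_sub_cancel_left] at hu
    nlinarith [Nat.mul_le_mul_right w hz, Nat.mul_le_mul_left a (show w ≤ n by omega)]

theorem card_add_le_card_filter_eq_zero_add_sum {J : Type*} [Fintype J] (x : J → ℕ) {k : J}
    (hk : x k ≠ 0) :
    Fintype.card J + x k ≤ Finset.card {j | x j = 0} + ∑ j, x j + 1 := by
  classical
  have hsupp : Finset.card {j | ¬x j = 0} ≤ ∑ j ∈ Finset.univ.erase k, x j + 1 := by
    rw [← Finset.card_erase_add_one (a := k) (by simpa using hk), ← Finset.filter_erase,
      Finset.card_filter]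
    gcongr with j
    split_ifs with hj
    exacts [Nat.zero_le _, Nat.one_le_iff_ne_zero.2 hj]
  have hsplit := Finset.card_filter_add_card_filter_not (s := Finset.univ) fun j => x j = 0
  have hsum := Finset.add_sum_erase Finset.univ x (Finset.mem_univ k)
  rw [Finset.card_univ] at hsplit
  omega

variable {A J : Type*} [AddCancelCommMonoid A] [Fintype J] {R : Set A} {q n : ℕ}

/-- The columns `c` are too few to meet all of `J`, so the relation between two columns can be
compared with an empty column of `c`. -/
theorem IsRigid.forall_le_or_mul_le_sum_card (hR : IsRigid R q n) (hqn : q ≤ n + 1)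
    (hnJ : n < Fintype.card J) {c e : J → Multiset A} (hc : ∀ j, ∀ z ∈ c j, z ∈ R)
    (he : ∀ j, ∀ z ∈ e j, z ∈ R)
    (hce : ∀ j k, (c j).sum + (e k).sum = (c k).sum + (e j).sum)
    (hcq : ∑ j, card (c j) < q) :
    (∀ j, c j ≤ e j) ∨ (q - ∑ j, card (c j)) * n ≤ ∑ j, card (e j) := by
  classical
  rw [or_iff_not_imp_left, not_forall]
  rintro ⟨k, hk⟩
  have hk0 : card (c k) ≠ 0 := fun h => hk (card_eq_zero.1 h ▸ zero_le _)
  set Z : Finset J := {j | card (c j) = 0} with hZ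
  have hkZ : k ∉ Z := by simpa [hZ] using hk0
  have hcardZ : Fintype.card J + card (c k) ≤ Z.card + ∑ j, card (c j) + 1 :=
    card_add_le_card_filter_eq_zero_add_sum (fun j => card (c j)) hk0
  have hck : card (c k) ≤ ∑ j, card (c j) :=
    Finset.single_le_sum (f := fun j => card (c j)) (fun _ _ => Nat.zero_le _)
      (Finset.mem_univ k)
  obtain ⟨j₀, hj₀, hmin⟩ := Z.exists_min_image (fun j => card (e j)) (Finset.card_pos.1 (by omega))
  have hcj₀ : c j₀ = 0 := by simpa [hZ] using hj₀
  have hek : (q - (card (c k) + card (e j₀))) * n ≤ card (e k) := by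
    obtain h | h := lt_or_ge (card (c k + e j₀)) q
    · refine ((hR (c k + e j₀) (e k) ?_ (he k) ?_ h).resolve_left fun hle => ?_).trans_eq' ?_
      · exact fun z hz => (mem_add.1 hz).elim (hc k z) (he j₀ z)
      · simpa [hcj₀] using hce k j₀
      · exact hk ((Multiset.le_add_right _ _).trans hle)
      · rw [card_add]
    · rw [← card_add, Nat.sub_eq_zero_of_le h, zero_mul]
      exact Nat.zero_le _
  calc (q - ∑ j, card (c j)) * n ≤ card (e k) + Z.card * card (e j₀) :=
        mul_le_add_mul_of_tsub_mul_le (a := ∑ j, card (c j) - card (c k)) (by omega) (by omega)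
          (hek.trans' (Nat.mul_le_mul_right n (by omega)))
    _ ≤ card (e k) + ∑ j ∈ Z, card (e j) := by
        gcongr
        simpa using Finset.card_nsmul_le_sum Z (fun j => card (e j)) _ hmin
    _ = ∑ j ∈ insert k Z, card (e j) := (Finset.sum_insert (f := fun j => card (e j)) hkZ).symm
    _ ≤ ∑ j, card (e j) := Finset.sum_le_sum_of_subset (Finset.subset_univ _)

theorem IsRigid.sum_card_mem (hR : IsRigid R q n) (hnJ : n < Fintype.card J)
    {S : AddSubmonoid ℕ} (hRS : vanishingLengths R ≤ S) (hJS : Fintype.card J ∈ S)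
    (hqnS : ∀ k, q * n ≤ k → k ∈ S) {s : J → Multiset A} (hs : ∀ j, ∀ z ∈ s j, z ∈ R)
    (hsum : ∀ j k, (s j).sum = (s k).sum) : ∑ j, card (s j) ∈ S := by
  classical
  have : Nonempty J := Fintype.card_pos_iff.1 (by omega)
  obtain ⟨j₀, hj₀⟩ := Finite.exists_min fun j => card (s j)
  by_cases hall : ∀ k, s j₀ ≤ s k
  · have hsplit : ∑ j, card (s j) = ∑ j, card (s j - s j₀) + Fintype.card J * card (s j₀) := by
      rw [← smul_eq_mul, ← Finset.card_univ, ← Finset.sum_const, ← Finset.sum_add_distrib]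
      exact Finset.sum_congr rfl fun j _ => by rw [← card_add, Multiset.sub_add_cancel (hall j)]
    rw [hsplit]
    refine S.add_mem (S.sum_mem fun j _ => hRS (card_mem_vanishingLengths
      (fun z hz => hs j z (mem_of_le (Multiset.sub_le_self _ _) hz)) ?_)) ?_
    · refine add_right_cancel (b := (s j₀).sum) ?_
      rw [← sum_add, Multiset.sub_add_cancel (hall j), zero_add, hsum j j₀]
    · simpa [mul_comm] using S.nsmul_mem hJS (card (s j₀))
  · obtain ⟨k, hk⟩ := not_forall.1 hall
    refine hqnS _ ?_
    have hsum_ge : card (s k) + n * card (s j₀) ≤ ∑ j, card (s j) := by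
      rw [← Finset.add_sum_erase _ _ (Finset.mem_univ k)]
      gcongr
      refine (Finset.card_nsmul_le_sum _ _ _ fun j _ => hj₀ j).trans' ?_
      rw [Finset.card_erase_of_mem (Finset.mem_univ k), Finset.card_univ, smul_eq_mul]
      exact Nat.mul_le_mul_right _ (by omega)
    obtain h | h := lt_or_ge (card (s j₀)) q
    · have hsk := (hR _ _ (hs j₀) (hs k) (hsum j₀ k) h).resolve_left hk
      obtain ⟨b, rfl⟩ := Nat.exists_eq_add_of_le h.le
      rw [Nat.add_sub_cancel_left] at hsk
      nlinarith
    · nlinarith [Nat.mul_le_mul_left n h]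

end Rigidity

section Columns

open Multiset

variable {R : Type*} [CommSemiring R] {p : ℕ}

/-- The multiset with columns `c`: the union of the dilates `ω ^ j • c j`. For `ω` of suitable
order this lists `(p * m)`-th roots of unity by their cosets modulo the `m`-th roots of unity. -/
def ofColumns (ω : R) (c : Fin p → Multiset R) : Multiset R :=
  ∑ j, (c j).map (ω ^ (j : ℕ) * ·)

theorem card_ofColumns (ω : R) (c : Fin p → Multiset R) :
    card (ofColumns ω c) = ∑ j, card (c j) := by
  simp only [ofColumns, card_sum, card_map]

theorem sum_ofColumns (ω : R) (c : Fin p → Multiset R) :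
    (ofColumns ω c).sum = ∑ j : Fin p, ω ^ (j : ℕ) * (c j).sum := by
  rw [ofColumns, sum_sum]
  exact Finset.sum_congr rfl fun j _ => by rw [sum_map_mul_left, map_id']

theorem ofColumns_le_ofColumns (ω : R) {c e : Fin p → Multiset R} (h : ∀ j, c j ≤ e j) :
    ofColumns ω c ≤ ofColumns ω e :=
  Finset.sum_le_sum fun j _ => map_le_map (h j)

theorem ofColumns_update_cons (ω : R) (c : Fin p → Multiset R) (j : Fin p) (z : R) :
    ofColumns ω (Function.update c j (z ::ₘ c j)) = ω ^ (j : ℕ) * z ::ₘ ofColumns ω c := by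
  simp only [ofColumns, ← Finset.add_sum_erase Finset.univ _ (Finset.mem_univ j),
    Function.update_self, map_cons, cons_add]
  congr 2
  exact Finset.sum_congr rfl fun k hk => by
    rw [Function.update_of_ne (Finset.ne_of_mem_erase hk)]

theorem exists_ofColumns_eq {K : Type*} [Field K] {m : ℕ} [NeZero p] [NeZero m] {ω : K}
    (hω : IsPrimitiveRoot (ω ^ m) p) {s : Multiset K} (hs : ∀ z ∈ s, z ^ (p * m) = 1) :
    ∃ c : Fin p → Multiset K, (∀ j, ∀ z ∈ c j, z ^ m = 1) ∧ ofColumns ω c = s := by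
  have hω0 : ω ≠ 0 := (pow_ne_zero_iff (NeZero.ne m)).1 (hω.ne_zero (NeZero.ne p))
  induction s using Multiset.induction with
  | empty => exact ⟨0, by simp, by simp [ofColumns]⟩
  | cons z s ih =>
    obtain ⟨c, hc, rfl⟩ := ih fun w hw => hs w (mem_cons_of_mem hw)
    obtain ⟨j, hj, hjz⟩ := hω.eq_pow_of_pow_eq_one (ξ := z ^ m)
      (by rw [← pow_mul, mul_comm]; exact hs z (mem_cons_self z _))
    refine ⟨Function.update c ⟨j, hj⟩ (z / ω ^ j ::ₘ c ⟨j, hj⟩), fun k => ?_, ?_⟩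
    · obtain rfl | hk := eq_or_ne k ⟨j, hj⟩
      · rw [Function.update_self, forall_mem_cons, div_pow, ← hjz, ← pow_mul, ← pow_mul, mul_comm,
          div_self (pow_ne_zero _ hω0)]
        exact ⟨rfl, hc _⟩
      · rw [Function.update_of_ne hk]
        exact hc k
    · rw [ofColumns_update_cons, mul_div_cancel₀ _ (pow_ne_zero j hω0)]

end Columns

section Cyclotomic

open IntermediateField Multiset Polynomial

variable {K : Type*} [Field K]

theorem totient_lcm_le_finrank_mul_natDegree_minpoly {F : Type*} [Field F] [Algebra ℚ F]
    [FiniteDimensional ℚ F] [Algebra F K] {m n : ℕ} {ξ : F} {ω : K} (hm : 0 < m) (hn : 0 < n)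
    (hξ : IsPrimitiveRoot ξ m) (hω : IsPrimitiveRoot ω n) :
    (m.lcm n).totient ≤ Module.finrank ℚ F * (minpoly F ω).natDegree := by
  algebraize [(algebraMap F K).comp (algebraMap ℚ F)]
  have hωi : IsIntegral F ω := (hω.isIntegral hn).tower_top
  have := adjoin.finiteDimensional hωi
  have := FiniteDimensional.trans ℚ F F⟮ω⟯
  rw [← adjoin.finrank hωi, Module.finrank_mul_finrank ℚ F F⟮ω⟯]
  have hgen : IsPrimitiveRoot (AdjoinSimple.gen F ω) n :=
    IsPrimitiveRoot.of_map_of_injective (f := algebraMap F⟮ω⟯ K) (by simpa using hω)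
      (algebraMap F⟮ω⟯ K).injective
  exact (hξ.map_of_injective (algebraMap F F⟮ω⟯).injective).lcm_totient_le_finrank hgen
    (cyclotomic.irreducible_rat (Nat.lcm_pos hm hn))

variable [CharZero K]

theorem totient_lcm_le_totient_mul_natDegree_minpoly {m n : ℕ} {ξ ω : K} (hm : 0 < m) (hn : 0 < n)
    (hξ : IsPrimitiveRoot ξ m) (hω : IsPrimitiveRoot ω n) :
    (m.lcm n).totient ≤ m.totient * (minpoly ℚ⟮ξ⟯ ω).natDegree := by
  have hξi : IsIntegral ℚ ξ := (hξ.isIntegral hm).tower_top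
  have := adjoin.finiteDimensional hξi
  have hfinrank : Module.finrank ℚ ℚ⟮ξ⟯ = m.totient := by
    rw [adjoin.finrank hξi, ← cyclotomic_eq_minpoly_rat hξ hm, natDegree_cyclotomic]
  have hgen : IsPrimitiveRoot (AdjoinSimple.gen ℚ ξ) m :=
    IsPrimitiveRoot.of_map_of_injective (f := algebraMap ℚ⟮ξ⟯ K) (by simpa using hξ)
      (algebraMap ℚ⟮ξ⟯ K).injective
  rw [← hfinrank]
  exact totient_lcm_le_finrank_mul_natDegree_minpoly hm hn hgen hω

theorem sum_mem_adjoin_of_isPrimitiveRoot {m : ℕ} [NeZero m] {ξ : K} (hξ : IsPrimitiveRoot ξ m)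
    {s : Multiset K} (hs : ∀ z ∈ s, z ^ m = 1) : s.sum ∈ ℚ⟮ξ⟯ :=
  multiset_sum_mem _ fun z hz => by
    obtain ⟨i, -, rfl⟩ := hξ.eq_pow_of_pow_eq_one (hs z hz)
    exact pow_mem (mem_adjoin_simple_self ℚ ξ) i

theorem eq_of_sum_pow_mul_eq {F : IntermediateField ℚ K} {ω : K} {n : ℕ}
    (hn : n ≤ (minpoly F ω).natDegree) {α β : Fin n → K} (hα : ∀ j, α j ∈ F) (hβ : ∀ j, β j ∈ F)
    (h : ∑ j : Fin n, ω ^ (j : ℕ) * α j = ∑ j : Fin n, ω ^ (j : ℕ) * β j) (j : Fin n) :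
    α j = β j := by
  have hli := (linearIndependent_pow (K := F) ω).comp _ (Fin.castLE_injective hn)
  have heq : (fun j => (⟨α j, hα j⟩ : F)) = fun j => ⟨β j, hβ j⟩ := by
    apply linearIndependent_iff_injective_fintypeLinearCombination.1 hli
    simpa [Fintype.linearCombination_apply, Algebra.smul_def, mul_comm] using h
  exact congrArg Subtype.val (congrFun heq j)

theorem sum_eq_sum_of_sum_ofColumns_eq {p m : ℕ} (hp : p.Prime) (hm : 0 < m) (hpm : p ∣ m) {ζ : K}
    (hζ : IsPrimitiveRoot ζ (p * m)) {c e : Fin p → Multiset K} (hc : ∀ j, ∀ z ∈ c j, z ^ m = 1)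
    (he : ∀ j, ∀ z ∈ e j, z ^ m = 1) (h : (ofColumns ζ c).sum = (ofColumns ζ e).sum) (j : Fin p) :
    (c j).sum = (e j).sum := by
  have : NeZero m := ⟨hm.ne'⟩
  have hpm0 : 0 < p * m := Nat.mul_pos hp.pos hm
  have hξ : IsPrimitiveRoot (ζ ^ p) m := hζ.pow hpm0 rfl
  have hdeg := totient_lcm_le_totient_mul_natDegree_minpoly hm hpm0 hξ hζ
  rw [Nat.lcm_eq_right (dvd_mul_left m p), Nat.totient_mul_of_prime_of_dvd hp hpm, mul_comm] at hdeg
  rw [sum_ofColumns, sum_ofColumns] at h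
  exact eq_of_sum_pow_mul_eq (Nat.le_of_mul_le_mul_left hdeg (Nat.totient_pos.2 hm))
    (fun j => sum_mem_adjoin_of_isPrimitiveRoot hξ (hc j))
    (fun j => sum_mem_adjoin_of_isPrimitiveRoot hξ (he j)) h j

/-- Since `1 + ω + ⋯ + ω ^ (p - 1) = 0` is the only relation between the powers of `ω`, two
representations of a number by columns differ by a constant. -/
theorem sum_add_sum_eq_of_sum_ofColumns_eq {p m : ℕ} (hp : p.Prime) (hm : 0 < m) (hpm : ¬p ∣ m)
    {ξ ω : K} (hξ : IsPrimitiveRoot ξ m) (hω : IsPrimitiveRoot ω p) {c e : Fin p → Multiset K}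
    (hc : ∀ j, ∀ z ∈ c j, z ^ m = 1) (he : ∀ j, ∀ z ∈ e j, z ^ m = 1)
    (h : (ofColumns ω c).sum = (ofColumns ω e).sum) (j k : Fin p) :
    (c j).sum + (e k).sum = (c k).sum + (e j).sum := by
  have : NeZero m := ⟨hm.ne'⟩
  have hdeg := totient_lcm_le_totient_mul_natDegree_minpoly hm hp.pos hξ hω
  rw [Nat.Coprime.lcm_eq_mul ((Nat.Prime.coprime_iff_not_dvd hp).2 hpm).symm, mul_comm m,
    Nat.totient_mul_of_prime_of_not_dvd hp hpm, mul_comm] at hdeg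
  replace hdeg := Nat.le_of_mul_le_mul_left hdeg (Nat.totient_pos.2 hm)
  obtain ⟨n, rfl⟩ := Nat.exists_eq_add_one.2 hp.pos
  rw [Nat.add_sub_cancel] at hdeg
  have hgeom := hω.geom_sum_eq_zero hp.one_lt
  rw [sum_ofColumns, sum_ofColumns, Fin.sum_univ_castSucc, Fin.sum_univ_castSucc] at h
  rw [Finset.sum_range, Fin.sum_univ_castSucc] at hgeom
  have hmem : ∀ {s : Multiset K}, (∀ z ∈ s, z ^ m = 1) → s.sum ∈ ℚ⟮ξ⟯ :=
    sum_mem_adjoin_of_isPrimitiveRoot hξ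
  have hlast : ∀ i : Fin n, (c i.castSucc).sum - (c (Fin.last n)).sum =
      (e i.castSucc).sum - (e (Fin.last n)).sum :=
    eq_of_sum_pow_mul_eq hdeg (fun i => sub_mem (hmem (hc _)) (hmem (hc _)))
      (fun i => sub_mem (hmem (he _)) (hmem (he _))) (by
        simp only [mul_sub, Finset.sum_sub_distrib, ← Finset.sum_mul, Fin.val_castSucc] at h hgeom ⊢
        linear_combination h - ((c (Fin.last n)).sum - (e (Fin.last n)).sum) * hgeom)
  have hconst : ∀ i, (c i).sum - (e i).sum = (c (Fin.last n)).sum - (e (Fin.last n)).sum := by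
    refine Fin.lastCases rfl fun i => ?_
    linear_combination hlast i
  linear_combination hconst j - hconst k

end Cyclotomic

section LamLeung

open Multiset

section Semiring

variable {R : Type*} [Semiring R]

theorem sum_eq_card_of_forall_eq_one {u : Multiset R} (hu : ∀ z ∈ u, z = 1) : u.sum = card u := by
  conv_lhs => rw [eq_replicate_card.2 hu]
  rw [sum_replicate, nsmul_one]

variable [CharZero R]

theorem le_of_forall_eq_one_of_sum_eq_sum_add {s t u : Multiset R} (hs : ∀ z ∈ s, z = 1)
    (ht : ∀ z ∈ t, z = 1) (hu : ∀ z ∈ u, z = 1) (h : t.sum = s.sum + u.sum) : s ≤ t := by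
  rw [sum_eq_card_of_forall_eq_one hs, sum_eq_card_of_forall_eq_one ht,
    sum_eq_card_of_forall_eq_one hu] at h
  rw [eq_replicate_card.2 hs, eq_replicate_card.2 ht, replicate_le_replicate]
  norm_cast at h
  omega

theorem isRigid_singleton_one (q n : ℕ) : IsRigid ({1} : Set R) q n := fun _ _ hs ht hst _ =>
  Or.inl (le_of_forall_eq_one_of_sum_eq_sum_add (u := 0) hs ht (by simp) (by simpa using hst.symm))

end Semiring

variable {K : Type*} [Field K] [CharZero K]

theorem IsRigid.pow_mul_eq_one_of_dvd {p m q n : ℕ} (hR : IsRigid {z : K | z ^ m = 1} q n)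
    (hp : p.Prime) (hm : 0 < m) (hpm : p ∣ m) {ζ : K} (hζ : IsPrimitiveRoot ζ (p * m)) :
    IsRigid {z : K | z ^ (p * m) = 1} q n := by
  intro s t hs ht hst hsq
  have : NeZero p := ⟨hp.ne_zero⟩
  have : NeZero m := ⟨hm.ne'⟩
  have hω : IsPrimitiveRoot (ζ ^ m) p := hζ.pow (Nat.mul_pos hp.pos hm) (mul_comm p m)
  obtain ⟨c, hc, rfl⟩ := exists_ofColumns_eq hω hs
  obtain ⟨e, he, rfl⟩ := exists_ofColumns_eq hω ht
  rw [card_ofColumns] at hsq ⊢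
  rw [card_ofColumns]
  have hle : ∀ (c : Fin p → Multiset K) j, card (c j) ≤ ∑ j, card (c j) := fun c j =>
    Finset.single_le_sum (f := fun j => card (c j)) (fun _ _ => Nat.zero_le _) (Finset.mem_univ j)
  by_cases hall : ∀ j, c j ≤ e j
  · exact Or.inl (ofColumns_le_ofColumns ζ hall)
  · obtain ⟨j, hj⟩ := not_forall.1 hall
    have hej := (hR (c j) (e j) (hc j) (he j)
      (sum_eq_sum_of_sum_ofColumns_eq hp hm hpm hζ hc he hst j)
      ((hle c j).trans_lt hsq)).resolve_left hj
    refine Or.inr ((Nat.mul_le_mul_right n ?_).trans (hej.trans (hle e j)))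
    exact Nat.sub_le_sub_left (hle c j) q

theorem IsRigid.pow_mul_eq_one_of_not_dvd {p m q n : ℕ} (hR : IsRigid {z : K | z ^ m = 1} q n)
    (hqn : q ≤ n + 1) (hnp : n < p) (hp : p.Prime) (hm : 0 < m) (hpm : ¬p ∣ m) {ζ : K}
    (hζ : IsPrimitiveRoot ζ (p * m)) : IsRigid {z : K | z ^ (p * m) = 1} q n := by
  intro s t hs ht hst hsq
  have : NeZero p := ⟨hp.ne_zero⟩
  have : NeZero m := ⟨hm.ne'⟩
  have hpm0 := Nat.mul_pos hp.pos hm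
  have hω : IsPrimitiveRoot (ζ ^ m) p := hζ.pow hpm0 (mul_comm p m)
  have hωm : IsPrimitiveRoot ((ζ ^ m) ^ m) p :=
    hω.pow_of_coprime m ((Nat.Prime.coprime_iff_not_dvd hp).2 hpm).symm
  obtain ⟨c, hc, rfl⟩ := exists_ofColumns_eq hωm hs
  obtain ⟨e, he, rfl⟩ := exists_ofColumns_eq hωm ht
  rw [card_ofColumns] at hsq ⊢
  rw [card_ofColumns]
  exact (hR.forall_le_or_mul_le_sum_card hqn (by rwa [Fintype.card_fin]) hc he
    (sum_add_sum_eq_of_sum_ofColumns_eq hp hm hpm (hζ.pow hpm0 rfl) hω hc he hst) hsq).imp_left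
      (ofColumns_le_ofColumns _)

/-- Some column of `s` is empty, which determines the constant by which the columns differ. -/
theorem isRigid_pow_eq_one_of_prime {p : ℕ} (hp : p.Prime) (n : ℕ) {ζ : K}
    (hζ : IsPrimitiveRoot ζ p) : IsRigid {z : K | z ^ p = 1} p n := by
  intro s t hs ht hst hsp
  have : NeZero p := ⟨hp.ne_zero⟩
  obtain ⟨c, hc, rfl⟩ := exists_ofColumns_eq (m := 1) (ω := ζ) (s := s) (by rwa [pow_one])
    (by rwa [mul_one])
  obtain ⟨e, he, rfl⟩ := exists_ofColumns_eq (m := 1) (ω := ζ) (s := t) (by rwa [pow_one])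
    (by rwa [mul_one])
  obtain ⟨j₀, -, hj₀⟩ := Finset.exists_lt_of_sum_lt (show ∑ j, card (c j) < ∑ _j : Fin p, 1 by
    simpa [card_ofColumns] using hsp)
  refine Or.inl (ofColumns_le_ofColumns _ fun j => ?_)
  have h := sum_add_sum_eq_of_sum_ofColumns_eq hp one_pos hp.not_dvd_one IsPrimitiveRoot.one hζ
    hc he hst j j₀
  rw [card_eq_zero.1 (Nat.lt_one_iff.1 hj₀), sum_zero, zero_add] at h
  simp only [pow_one] at hc he
  exact le_of_forall_eq_one_of_sum_eq_sum_add (hc j) (he j) (he j₀) h.symm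

@[elab_as_elim]
theorem induction_on_largest_prime {P : ℕ → Prop} (zero : P 0) (one : P 1)
    (mul : ∀ p m : ℕ, p.Prime → 0 < m → (∀ q : ℕ, q.Prime → q ∣ m → q ≤ p) → P m → P (p * m))
    (N : ℕ) : P N := by
  induction N using Nat.strong_induction_on with
  | _ N ih =>
    obtain rfl | hN0 := eq_or_ne N 0
    · exact zero
    obtain rfl | hN1 := eq_or_ne N 1
    · exact one
    obtain ⟨p, hp, hmax⟩ := N.primeFactors.exists_max_image id
      (Nat.nonempty_primeFactors.2 (by omega))
    have hpp := Nat.prime_of_mem_primeFactors hp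
    obtain ⟨m, rfl⟩ := Nat.dvd_of_mem_primeFactors hp
    have hm : 0 < m := Nat.pos_of_ne_zero (right_ne_zero_of_mul hN0)
    refine mul p m hpp hm (fun q hq hqm => hmax q ?_) (ih m ?_)
    · exact Nat.mem_primeFactors.2 ⟨hq, hqm.mul_left p, hN0⟩
    · exact lt_mul_of_one_lt_left hm hpp.one_lt

theorem isRigid_pow_eq_one {q n N : ℕ} (hqn : q ≤ n + 1) (hN : 0 < N)
    (hprime : ∀ l : ℕ, l.Prime → l ∣ N → l = q ∨ n < l) {ζ : K} (hζ : IsPrimitiveRoot ζ N) :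
    IsRigid {z : K | z ^ N = 1} q n := by
  induction N using induction_on_largest_prime generalizing ζ with
  | zero => exact absurd hN (lt_irrefl 0)
  | one => simpa only [pow_one, Set.ofPred_eq_eq_singleton] using isRigid_singleton_one q n
  | mul p m hp hm hmax ih =>
    have hprime_m : ∀ l : ℕ, l.Prime → l ∣ m → l = q ∨ n < l := fun l hl hlm =>
      hprime l hl (hlm.mul_left p)
    have hR := ih hm hprime_m (hζ.pow (Nat.mul_pos hp.pos hm) rfl)
    by_cases hpm : p ∣ m
    · exact hR.pow_mul_eq_one_of_dvd hp hm hpm hζ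
    obtain hnp | hpn := lt_or_ge n p
    · exact hR.pow_mul_eq_one_of_not_dvd hqn hnp hp hm hpm hζ
    obtain rfl : p = q := (hprime p hp (dvd_mul_right p m)).resolve_right hpn.not_gt
    obtain rfl : m = 1 := Nat.eq_one_iff_not_exists_prime_dvd.2 fun l hl hlm => by
      obtain rfl | hnl := hprime_m l hl hlm
      · exact hpm hlm
      · exact absurd (hmax l hl hlm) (by omega)
    rw [mul_one] at hζ ⊢
    exact isRigid_pow_eq_one_of_prime hp n hζ

theorem vanishingLengths_pow_mul_eq_one_le_of_dvd {p m : ℕ} {S : AddSubmonoid ℕ}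
    (hS : vanishingLengths {z : K | z ^ m = 1} ≤ S) (hp : p.Prime) (hm : 0 < m) (hpm : p ∣ m)
    {ζ : K} (hζ : IsPrimitiveRoot ζ (p * m)) : vanishingLengths {z : K | z ^ (p * m) = 1} ≤ S := by
  rintro _ ⟨s, hs, hs0, rfl⟩
  have : NeZero p := ⟨hp.ne_zero⟩
  have : NeZero m := ⟨hm.ne'⟩
  obtain ⟨c, hc, rfl⟩ := exists_ofColumns_eq (hζ.pow (Nat.mul_pos hp.pos hm) (mul_comm p m)) hs
  rw [card_ofColumns]
  refine S.sum_mem fun j _ => hS (card_mem_vanishingLengths (hc j) ?_)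
  exact sum_eq_sum_of_sum_ofColumns_eq (e := 0) hp hm hpm hζ hc (by simp)
    (by simpa [sum_ofColumns] using hs0) j

theorem exists_columns_of_mem_vanishingLengths {p m : ℕ} (hp : p.Prime) (hm : 0 < m)
    (hpm : ¬p ∣ m) {ζ : K} (hζ : IsPrimitiveRoot ζ (p * m)) {k : ℕ}
    (hk : k ∈ vanishingLengths {z : K | z ^ (p * m) = 1}) :
    ∃ c : Fin p → Multiset K, (∀ j, ∀ z ∈ c j, z ^ m = 1) ∧ (∀ i j, (c i).sum = (c j).sum) ∧
      ∑ j, card (c j) = k := by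
  obtain ⟨s, hs, hs0, rfl⟩ := hk
  have : NeZero p := ⟨hp.ne_zero⟩
  have : NeZero m := ⟨hm.ne'⟩
  have hpm0 := Nat.mul_pos hp.pos hm
  have hω : IsPrimitiveRoot (ζ ^ m) p := hζ.pow hpm0 (mul_comm p m)
  obtain ⟨c, hc, rfl⟩ := exists_ofColumns_eq
    (hω.pow_of_coprime m ((Nat.Prime.coprime_iff_not_dvd hp).2 hpm).symm) hs
  refine ⟨c, hc, fun i j => ?_, (card_ofColumns _ c).symm⟩
  simpa using sum_add_sum_eq_of_sum_ofColumns_eq (e := 0) hp hm hpm (hζ.pow hpm0 rfl) hω hc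
    (by simp) (by simpa [sum_ofColumns] using hs0) i j

theorem vanishingLengths_pow_eq_one_le_of_prime {p : ℕ} {S : AddSubmonoid ℕ} (hp : p.Prime)
    (hpS : p ∈ S) {ζ : K} (hζ : IsPrimitiveRoot ζ p) :
    vanishingLengths {z : K | z ^ p = 1} ≤ S := by
  intro k hk
  have : NeZero p := ⟨hp.ne_zero⟩
  rw [← mul_one p] at hζ hk
  obtain ⟨c, hc, hsum, rfl⟩ :=
    exists_columns_of_mem_vanishingLengths hp one_pos hp.not_dvd_one hζ hk
  simp only [pow_one] at hc
  have hcard : ∀ j, card (c j) = card (c 0) := fun j => by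
    simpa only [sum_eq_card_of_forall_eq_one (hc _), Nat.cast_inj] using hsum j 0
  simpa [hcard, mul_comm] using S.nsmul_mem hpS (card (c 0))

/-- Above the Frobenius number of the two least prime factors `q < r` every number is a combination
of `q` and `r`; rigidity with these parameters takes care of the rest. -/
theorem vanishingLengths_pow_mul_eq_one_le_of_not_dvd {p m : ℕ} {S : AddSubmonoid ℕ}
    (hp : p.Prime) (hm : 1 < m) (hpm : ¬p ∣ m) (hmax : ∀ q : ℕ, q.Prime → q ∣ m → q ≤ p)
    (hS : vanishingLengths {z : K | z ^ m = 1} ≤ S) (hprime : ∀ l ∈ (p * m).primeFactors, l ∈ S)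
    {ζ : K} (hζ : IsPrimitiveRoot ζ (p * m)) : vanishingLengths {z : K | z ^ (p * m) = 1} ≤ S := by
  have hpm0 : p * m ≠ 0 := mul_ne_zero hp.ne_zero (by omega)
  set q := m.minFac
  have hq : q.Prime := Nat.minFac_prime hm.ne'
  have hqm : q ∣ m := Nat.minFac_dvd m
  have hqp : q < p := (hmax q hq hqm).lt_of_ne fun h => hpm (h ▸ hqm)
  have hp_mem : p ∈ (p * m).primeFactors.erase q :=
    Finset.mem_erase.2 ⟨hqp.ne', Nat.mem_primeFactors.2 ⟨hp, dvd_mul_right p m, hpm0⟩⟩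
  obtain ⟨r, hr_mem, hr_min⟩ := ((p * m).primeFactors.erase q).exists_min_image id ⟨p, hp_mem⟩
  obtain ⟨hrq, hrpm⟩ := Finset.mem_erase.1 hr_mem
  obtain ⟨hr, hr_dvd, -⟩ := Nat.mem_primeFactors.1 hrpm
  have hqr : q < r := by
    obtain h | h := hr.dvd_mul.1 hr_dvd
    · rwa [(Nat.prime_dvd_prime_iff_eq hr hp).1 h]
    · exact (Nat.minFac_le_of_dvd hr.two_le h).lt_of_ne hrq.symm
  have hqS : q ∈ S := hprime q (Nat.mem_primeFactors.2 ⟨hq, hqm.mul_left p, hpm0⟩)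
  have hRm : IsRigid {z : K | z ^ m = 1} q (r - 1) := by
    refine isRigid_pow_eq_one (by omega) (by omega) (fun l hl hlm => ?_)
      (hζ.pow (Nat.pos_of_ne_zero hpm0) rfl)
    refine or_iff_not_imp_left.2 fun hlq => (Nat.sub_lt hr.pos one_pos).trans_le (hr_min l ?_)
    exact Finset.mem_erase.2 ⟨hlq, Nat.mem_primeFactors.2 ⟨hl, hlm.mul_left p, hpm0⟩⟩
  have hconductor : ∀ k, q * (r - 1) ≤ k → k ∈ S := fun k hk => by
    have hcop : q.gcd r = 1 := (Nat.coprime_primes hq hr).2 hqr.ne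
    obtain ⟨a, b, rfl⟩ := Nat.exists_add_mul_eq_of_gcd_dvd_of_mul_pred_le q r k
      (hcop ▸ one_dvd k) (hk.trans' (Nat.mul_le_mul_right _ (Nat.pred_le q)))
    exact S.add_mem (S.nsmul_mem hqS a) (S.nsmul_mem (hprime r hrpm) b)
  intro k hk
  obtain ⟨c, hc, hsum, rfl⟩ := exists_columns_of_mem_vanishingLengths hp (by omega) hpm hζ hk
  have hrp : r ≤ p := hr_min p hp_mem
  exact hRm.sum_card_mem (by rw [Fintype.card_fin]; omega) hS
    (by rw [Fintype.card_fin]; exact hprime p (Finset.mem_of_mem_erase hp_mem)) hconductor hc hsum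

/-- **Lam–Leung theorem**. -/
theorem vanishingLengths_pow_eq_one_le_closure {N : ℕ} (hN : 0 < N) {ζ : K}
    (hζ : IsPrimitiveRoot ζ N) :
    vanishingLengths {z : K | z ^ N = 1} ≤ AddSubmonoid.closure (N.primeFactors : Set ℕ) := by
  induction N using induction_on_largest_prime generalizing ζ with
  | zero => exact absurd hN (lt_irrefl 0)
  | one =>
    rintro _ ⟨s, hs, hs0, rfl⟩
    simp only [Set.mem_ofPred_eq, pow_one] at hs
    rw [sum_eq_card_of_forall_eq_one hs, Nat.cast_eq_zero] at hs0
    exact hs0 ▸ zero_mem _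
  | mul p m hp hm hmax ih =>
    have hprime : ∀ l ∈ (p * m).primeFactors,
        l ∈ AddSubmonoid.closure ((p * m).primeFactors : Set ℕ) := fun l hl =>
      AddSubmonoid.subset_closure hl
    have ih := (ih hm (hζ.pow hN rfl)).trans (AddSubmonoid.closure_mono
      (Finset.coe_subset.2 (Nat.primeFactors_mono (dvd_mul_left m p) hN.ne')))
    by_cases hpm : p ∣ m
    · exact vanishingLengths_pow_mul_eq_one_le_of_dvd ih hp hm hpm hζ
    obtain rfl | hm1 := eq_or_ne m 1
    · rw [mul_one] at hζ hprime ⊢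
      exact vanishingLengths_pow_eq_one_le_of_prime hp (hprime p (by simp [hp])) hζ
    · exact vanishingLengths_pow_mul_eq_one_le_of_not_dvd hp (by omega) hpm hmax ih hprime hζ

end LamLeung

section Spectrum

open Multiset

theorem hasEigenvalue_toLin'_map_iff {n K L : Type*} [Fintype n] [DecidableEq n] [Field K]
    [Field L] (f : K →+* L) (M : Matrix n n K) (μ : K) :
    Module.End.HasEigenvalue (Matrix.toLin' (M.map f)) (f μ) ↔
      Module.End.HasEigenvalue (Matrix.toLin' M) μ := by
  simp only [Module.End.hasEigenvalue_iff_isRoot_charpoly, Matrix.charpoly_toLin',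
    Matrix.charpoly_map]
  exact Polynomial.isRoot_map_iff f.injective

open Classical in
theorem adjMatrix_addCayley_mulVec {G R : Type*} [AddCommGroup G] [Fintype G]
    [NonAssocSemiring R] {S : Finset G} (h0 : 0 ∉ S) (hneg : ∀ g ∈ S, -g ∈ S) (f : G → R) (u : G) :
    ((SimpleGraph.addCayley (S : Set G)).adjMatrix R).mulVec f u = ∑ g ∈ S, f (u + g) := by
  have hadj : ∀ v, (SimpleGraph.addCayley (S : Set G)).Adj u v ↔ -u + v ∈ S := fun v => by
    rw [SimpleGraph.addCayley_adj, Finset.mem_coe, Finset.mem_coe]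
    refine ⟨fun ⟨_, h⟩ => h.elim id fun h => by simpa using hneg _ h, fun h => ⟨?_, Or.inl h⟩⟩
    rintro rfl
    exact h0 (by simpa using h)
  rw [SimpleGraph.adjMatrix_mulVec_apply]
  refine (Finset.sum_nbij' (u + ·) (-u + ·) ?_ ?_ ?_ ?_ ?_).symm <;> simp [hadj]

/-- The characters form an eigenbasis of the adjacency matrix. -/
theorem isGraphEigenvalue_addCayley_iff {G : Type*} [AddCommGroup G] [Fintype G] {S : Finset G}
    (h0 : 0 ∉ S) (hneg : ∀ g ∈ S, -g ∈ S) {μ : ℝ} :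
    IsGraphEigenvalue (SimpleGraph.addCayley (S : Set G)) μ ↔
      ∃ ψ : AddChar G ℂ, ∑ g ∈ S, ψ g = μ := by
  classical
  have hdiag : Matrix.toLin' ((SimpleGraph.addCayley (S : Set G)).adjMatrix ℂ) =
      Matrix.toLin (AddChar.complexBasis G) (AddChar.complexBasis G)
        (Matrix.diagonal fun ψ => ∑ g ∈ S, ψ g) := by
    refine (AddChar.complexBasis G).ext fun ψ => funext fun u => ?_
    rw [Matrix.toLin_self, Finset.sum_eq_single ψ]
    · rw [Matrix.toLin'_apply, AddChar.complexBasis_apply, Matrix.diagonal_apply_eq]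
      convert adjMatrix_addCayley_mulVec h0 hneg ψ u using 1
      simp only [Pi.smul_apply, smul_eq_mul, AddChar.map_add_eq_mul, ← Finset.mul_sum, mul_comm]
    · intro χ _ hχ
      rw [Matrix.diagonal_apply_ne _ hχ, zero_smul]
    · exact fun h => absurd (Finset.mem_univ ψ) h
  have hmap : ((SimpleGraph.addCayley (S : Set G)).adjMatrix ℝ).map Complex.ofRealHom =
      (SimpleGraph.addCayley (S : Set G)).adjMatrix ℂ := by
    ext u v
    simp [SimpleGraph.adjMatrix_apply]
  rw [← hasEigenvalue_toLin_diagonal_iff (fun ψ : AddChar G ℂ => ∑ g ∈ S, ψ g)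
    (AddChar.complexBasis G), ← hdiag, ← hmap, ← Complex.ofRealHom_eq_coe,
    hasEigenvalue_toLin'_map_iff]
  exact Iff.of_eq (by rw [IsGraphEigenvalue]; congr)

theorem torus_generators_injective (d : ℕ) {N : ℕ} (hN : 3 ≤ N) :
    Function.Injective (Sum.elim (fun i => Pi.single i 1) fun i => -Pi.single i 1 :
      Fin d ⊕ Fin d → Fin d → ZMod N) := by
  have : Fact (2 < N) := ⟨hN⟩
  have : Fact (1 < N) := ⟨by omega⟩
  have hinj : Function.Injective fun i : Fin d => (Pi.single i 1 : Fin d → ZMod N) :=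
    fun i j h => by simpa [Pi.single_apply] using congrFun h i
  refine hinj.sumElim (neg_injective.comp hinj) fun i j h => ?_
  have hi := congrFun h i
  rw [Pi.single_eq_same, Pi.neg_apply, Pi.single_apply] at hi
  split_ifs at hi
  · exact ZMod.neg_one_ne_one hi.symm
  · exact one_ne_zero (hi.trans neg_zero)

theorem isGraphEigenvalue_discreteTorus_iff_exists_addChar {d N : ℕ} [NeZero N] (hN : 3 ≤ N)
    {μ : ℝ} : IsGraphEigenvalue (discreteTorus d N) μ ↔ ∃ ψ : AddChar (Fin d → ZMod N) ℂ,
      ∑ i, (ψ (Pi.single i 1) + (ψ (Pi.single i 1))⁻¹) = μ := by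
  have : Fact (1 < N) := ⟨by omega⟩
  set S : Finset (Fin d → ZMod N) := Finset.univ.map ⟨_, torus_generators_injective d hN⟩ with hS
  have hmem : ∀ g, g ∈ S ↔ ∃ i : Fin d, g = Pi.single i 1 ∨ g = -Pi.single i 1 := fun g => by
    simp [hS, eq_comm, exists_or]
  have htorus : discreteTorus d N = SimpleGraph.addCayley (S : Set (Fin d → ZMod N)) := by
    rw [discreteTorus]
    congr 1
    exact Set.ext fun g => (hmem g).symm
  rw [htorus, isGraphEigenvalue_addCayley_iff]
  · simp only [hS, Finset.sum_map, Function.Embedding.coeFn_mk, Fintype.sum_sum_type, Sum.elim_inl,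
      Sum.elim_inr, AddChar.map_neg_eq_inv, Finset.sum_add_distrib]
  · rw [hmem]
    rintro ⟨i, h | h⟩ <;> simpa using congrFun h i
  · simp only [hmem]
    rintro g ⟨i, rfl | rfl⟩
    exacts [⟨i, Or.inr rfl⟩, ⟨i, Or.inl (neg_neg _)⟩]

theorem exists_addChar_single_eq_iff {ι M : Type*} [Finite ι] [DecidableEq ι] [CommMonoid M]
    {N : ℕ} [NeZero N] {z : ι → M} :
    (∃ ψ : AddChar (ι → ZMod N) M, ∀ i, ψ (Pi.single i 1) = z i) ↔ ∀ i, z i ^ N = 1 := by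
  constructor
  · rintro ⟨ψ, hψ⟩ i
    rw [← hψ, ← AddChar.map_nsmul_eq_pow, ← Pi.single_smul, nsmul_one, ZMod.natCast_self,
      Pi.single_zero, AddChar.map_zero_eq_one]
  · intro hz
    have := Fintype.ofFinite ι
    refine ⟨∏ i, (AddChar.zmodChar N (hz i)).compAddMonoidHom (Pi.evalAddMonoidHom _ i),
      fun i => ?_⟩
    rw [AddChar.prod_apply, Fintype.prod_eq_single i fun j hj => ?_]
    · simpa using AddChar.zmodChar_apply' (hz i) 1
    · simp [hj]

theorem exists_univ_val_map_eq {α : Type*} (s : Multiset α) :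
    ∃ f : Fin (card s) → α, Finset.univ.val.map f = s := by
  induction s using Quotient.inductionOn with
  | _ l => exact ⟨l.get, (Fin.univ_val_map _).trans (congrArg _ (List.ofFn_get l))⟩

theorem isGraphEigenvalue_discreteTorus_iff {d N : ℕ} [NeZero N] (hN : 3 ≤ N) {μ : ℝ} :
    IsGraphEigenvalue (discreteTorus d N) μ ↔
      ∃ s : Multiset ℂ, (∀ z ∈ s, z ^ N = 1) ∧ (s.map fun z => z + z⁻¹).sum = μ ∧ card s = d := by
  rw [isGraphEigenvalue_discreteTorus_iff_exists_addChar hN]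
  constructor
  · rintro ⟨ψ, hψ⟩
    refine ⟨Finset.univ.val.map fun i => ψ (Pi.single i 1), fun z hz => ?_, ?_, by simp⟩
    · obtain ⟨i, -, rfl⟩ := mem_map.1 hz
      exact exists_addChar_single_eq_iff.1 ⟨ψ, fun _ => rfl⟩ i
    · rw [map_map]
      exact hψ
  · rintro ⟨s, hs, hsum, rfl⟩
    obtain ⟨z, hz⟩ := exists_univ_val_map_eq s
    obtain ⟨ψ, hψ⟩ := exists_addChar_single_eq_iff.2 fun i =>
      hs (z i) (hz ▸ mem_map_of_mem z (Finset.mem_univ_val i))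
    refine ⟨ψ, ?_⟩
    simp only [hψ]
    rwa [← hz, map_map] at hsum

end Spectrum

section NullDimensions

open Multiset

theorem mem_vanishingLengths_image {A B : Type*} [AddCommMonoid A] {f : B → A} {R : Set B}
    {k : ℕ} : k ∈ vanishingLengths (f '' R) ↔
      ∃ s : Multiset B, (∀ z ∈ s, z ∈ R) ∧ (s.map f).sum = 0 ∧ card s = k := by
  constructor
  · rintro ⟨t, ht, ht0, rfl⟩
    choose g hgR hfg using ht
    refine ⟨t.attach.map fun z => g z.1 z.2, fun z hz => ?_, ?_, by rw [card_map, card_attach]⟩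
    · obtain ⟨w, -, rfl⟩ := mem_map.1 hz
      exact hgR w.1 w.2
    · simpa only [map_map, Function.comp_def, hfg, attach_map_val] using ht0
  · rintro ⟨s, hs, hs0, rfl⟩
    refine ⟨s.map f, fun z hz => ?_, hs0, card_map f s⟩
    obtain ⟨w, hw, rfl⟩ := mem_map.1 hz
    exact Set.mem_image_of_mem f (hs w hw)

/-- The lengths of vanishing sums of the eigenvalues `z + z⁻¹` of the `N`-cycle, `z ^ N = 1`; for
`3 ≤ N` these are the dimensions `d` in which `0` is an eigenvalue of the torus `T^d_N`. -/
def nullDimensions (N : ℕ) : AddSubmonoid ℕ :=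
  vanishingLengths ((fun z : ℂ => z + z⁻¹) '' {z | z ^ N = 1})

theorem mem_nullDimensions {N d : ℕ} : d ∈ nullDimensions N ↔
    ∃ s : Multiset ℂ, (∀ z ∈ s, z ^ N = 1) ∧ (s.map fun z => z + z⁻¹).sum = 0 ∧ card s = d :=
  mem_vanishingLengths_image

theorem isGraphEigenvalue_discreteTorus_zero_iff {d N : ℕ} [NeZero N] (hN : 3 ≤ N) :
    IsGraphEigenvalue (discreteTorus d N) 0 ↔ d ∈ nullDimensions N := by
  rw [isGraphEigenvalue_discreteTorus_iff hN, mem_nullDimensions, Complex.ofReal_zero]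

theorem one_mem_nullDimensions {N : ℕ} (hN : 4 ∣ N) : 1 ∈ nullDimensions N := by
  obtain ⟨m, rfl⟩ := hN
  refine mem_nullDimensions.2 ⟨{Complex.I}, fun z hz => ?_, ?_, card_singleton _⟩
  · rw [mem_singleton.1 hz, pow_mul, Complex.I_pow_four, one_pow]
  · rw [map_singleton, sum_singleton, Complex.inv_I, add_neg_cancel]

theorem two_mem_nullDimensions {N : ℕ} (hN : 2 ∣ N) : 2 ∈ nullDimensions N := by
  refine mem_nullDimensions.2 ⟨{1, -1}, ?_, ?_, rfl⟩
  · simp [(even_iff_two_dvd.2 hN).neg_one_pow]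
  · simp

theorem sum_pow_add_inv_eq_neg_one {K : Type*} [Field K] {k : ℕ} (hk : k ≠ 0) {ω : K}
    (hω : IsPrimitiveRoot ω (2 * k + 1)) :
    ∑ j ∈ Finset.range k, (ω ^ (j + 1) + (ω ^ (j + 1))⁻¹) = -1 := by
  have hinv : ∀ j ∈ Finset.range k, (ω ^ (j + 1))⁻¹ = ω ^ (k + (k - 1 - j) + 1) := fun j hj => by
    have := Finset.mem_range.1 hj
    refine inv_eq_of_mul_eq_one_right ?_
    rw [← pow_add, ← hω.pow_eq_one]
    congr 1
    omega
  have hgeom := hω.geom_sum_eq_zero (by omega)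
  rw [Finset.sum_range_succ', two_mul, Finset.sum_range_add, pow_zero] at hgeom
  rw [Finset.sum_add_distrib, Finset.sum_congr rfl hinv,
    Finset.sum_range_reflect fun j => ω ^ (k + j + 1)]
  linear_combination hgeom

theorem exists_sum_map_add_inv_eq_neg_one {n N : ℕ} (hn : Odd n) (hn1 : n ≠ 1) (hnN : n ∣ N) :
    ∃ s : Multiset ℂ, (∀ z ∈ s, z ^ N = 1) ∧ (s.map fun z => z + z⁻¹).sum = -1 ∧
      2 * card s + 1 = n := by
  obtain ⟨k, rfl⟩ := hn
  obtain ⟨m, rfl⟩ := hnN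
  have hω := Complex.isPrimitiveRoot_exp (2 * k + 1) (by omega)
  set ω := Complex.exp (2 * Real.pi * Complex.I / (2 * k + 1 : ℕ))
  refine ⟨(range k).map fun j => ω ^ (j + 1), fun z hz => ?_, ?_, by rw [card_map, card_range]⟩
  · obtain ⟨j, -, rfl⟩ := mem_map.1 hz
    rw [pow_right_comm, pow_mul, hω.pow_eq_one, one_pow, one_pow]
  · rw [map_map]
    exact sum_pow_add_inv_eq_neg_one (by omega) hω

theorem mem_nullDimensions_of_odd_of_dvd {n N : ℕ} (hn : Odd n) (hn1 : n ≠ 1) (hnN : n ∣ N) :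
    n ∈ nullDimensions N := by
  obtain ⟨s, hs, hsum, hcard⟩ := exists_sum_map_add_inv_eq_neg_one hn hn1 hnN
  refine mem_nullDimensions.2 ⟨s + s + {1}, ?_, ?_, ?_⟩
  · simp only [mem_add, mem_singleton]
    rintro z ((hz | hz) | rfl)
    exacts [hs z hz, hs z hz, one_pow N]
  · simp only [Multiset.map_add, sum_add, hsum, map_singleton, sum_singleton]
    norm_num
  · rw [card_add, card_add, card_singleton, ← two_mul, hcard]

theorem even_mem_nullDimensions {d N : ℕ} (hd : Even d) (hN : 2 ∣ N) : d ∈ nullDimensions N := by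
  obtain ⟨k, rfl⟩ := even_iff_two_dvd.1 hd
  simpa only [smul_eq_mul, mul_comm] using
    (nullDimensions N).nsmul_mem (two_mem_nullDimensions hN) k

theorem mem_nullDimensions_of_odd_of_dvd_of_le {d n N : ℕ} (hd : Odd d) (hn : Odd n) (hn1 : n ≠ 1)
    (hN : 2 ∣ N) (hnN : n ∣ N) (hnd : n ≤ d) : d ∈ nullDimensions N := by
  obtain ⟨k, rfl⟩ := Nat.exists_eq_add_of_le hnd
  exact add_mem (mem_nullDimensions_of_odd_of_dvd hn hn1 hnN)
    (even_mem_nullDimensions ((Nat.odd_add.1 hd).1 hn) hN)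

theorem exists_sum_eq_sum_map_add_inv {K : Type*} [Field K] {N : ℕ} {s : Multiset K}
    (hs : ∀ z ∈ s, z ^ N = 1) : ∃ u : Multiset K, (∀ z ∈ u, z ^ N = 1) ∧
      u.sum = (s.map fun z => z + z⁻¹).sum ∧ card u = 2 * card s := by
  refine ⟨s + s.map (·⁻¹), fun z hz => ?_, ?_, ?_⟩
  · obtain hz | hz := mem_add.1 hz
    · exact hs z hz
    · obtain ⟨w, hw, rfl⟩ := mem_map.1 hz
      rw [inv_pow, hs w hw, inv_one]
  · rw [sum_map_add, map_id', sum_add]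
  · rw [card_add, card_map, two_mul]

theorem two_mul_mem_closure_of_mem_nullDimensions {d N : ℕ} (hN : 0 < N)
    (hd : d ∈ nullDimensions N) : 2 * d ∈ AddSubmonoid.closure (N.primeFactors : Set ℕ) := by
  obtain ⟨s, hs, hs0, rfl⟩ := mem_nullDimensions.1 hd
  obtain ⟨u, hu, hsum, hcard⟩ := exists_sum_eq_sum_map_add_inv hs
  rw [← hcard]
  exact vanishingLengths_pow_eq_one_le_closure hN (Complex.isPrimitiveRoot_exp N hN.ne')
    (card_mem_vanishingLengths hu (hsum.trans hs0))

theorem exists_sum_map_add_inv_eq_neg_of_mem_closure {N k : ℕ} (hN : Odd N)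
    (hk : k ∈ AddSubmonoid.closure (N.primeFactors : Set ℕ)) :
    ∃ (s : Multiset ℂ) (e : ℕ), (∀ z ∈ s, z ^ N = 1) ∧ (s.map fun z => z + z⁻¹).sum = -e ∧
      2 * card s + e = k := by
  induction hk using AddSubmonoid.closure_induction with
  | mem l hl =>
    have hlN := Nat.dvd_of_mem_primeFactors hl
    obtain ⟨s, hs, hsum, hcard⟩ := exists_sum_map_add_inv_eq_neg_one (hN.of_dvd_nat hlN)
      (Nat.prime_of_mem_primeFactors hl).ne_one hlN
    exact ⟨s, 1, hs, by simpa using hsum, hcard⟩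
  | zero => exact ⟨0, 0, by simp⟩
  | add a b _ _ iha ihb =>
    obtain ⟨s, e, hs, hs_sum, rfl⟩ := iha
    obtain ⟨t, f, ht, ht_sum, rfl⟩ := ihb
    refine ⟨s + t, e + f, fun z hz => (mem_add.1 hz).elim (hs z) (ht z), ?_, ?_⟩
    · rw [Multiset.map_add, sum_add, hs_sum, ht_sum]
      push_cast
      ring
    · rw [card_add]
      ring

theorem mem_nullDimensions_iff_of_odd {d N : ℕ} (hN : Odd N) :
    d ∈ nullDimensions N ↔ 2 * d ∈ AddSubmonoid.closure (N.primeFactors : Set ℕ) := by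
  refine ⟨two_mul_mem_closure_of_mem_nullDimensions hN.pos, fun hd => ?_⟩
  obtain ⟨s, e, hs, hsum, hcard⟩ := exists_sum_map_add_inv_eq_neg_of_mem_closure hN hd
  obtain ⟨f, rfl⟩ : 2 ∣ e := by omega
  refine mem_nullDimensions.2 ⟨s + replicate f 1, fun z hz => ?_, ?_, ?_⟩
  · obtain hz | hz := mem_add.1 hz
    exacts [hs z hz, by rw [eq_of_mem_replicate hz, one_pow]]
  · rw [Multiset.map_add, sum_add, hsum, map_replicate, sum_replicate]
    simp only [nsmul_eq_mul]
    push_cast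
    ring
  · rw [card_add, card_replicate]
    omega

theorem odd_or_two_mul_le_of_mem_closure {S : Set ℕ} {b : ℕ} (hS : ∀ l ∈ S, Odd l ∧ b ≤ l)
    {k : ℕ} (hk : k ∈ AddSubmonoid.closure S) : k = 0 ∨ Odd k ∧ b ≤ k ∨ 2 * b ≤ k := by
  induction hk using AddSubmonoid.closure_induction with
  | mem l hl => exact Or.inr (Or.inl (hS l hl))
  | zero => exact Or.inl rfl
  | add m n _ _ ihm ihn =>
    simp only [Nat.odd_iff] at ihm ihn ⊢
    omega

/-- If `v` contained `u`, the difference would be a vanishing sum of even length less than twice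
every prime factor of `M`; otherwise rigidity makes `v` longer than it is. -/
theorem sum_ne_sum_of_card_lt_card {K : Type*} [Field K] [CharZero K] {M a b : ℕ} {ζ : K}
    (hζ : IsPrimitiveRoot ζ M) (hM : Odd M) (hab : Odd (a + b))
    (hprime : ∀ l : ℕ, l.Prime → l ∣ M → a + b < l) {u v : Multiset K}
    (hu : ∀ z ∈ u, z ^ M = 1) (hv : ∀ z ∈ v, z ^ M = 1) (hua : card u = 2 * a)
    (hvb : card v = 2 * b) (hlt : a < b) : u.sum ≠ v.sum := by
  classical
  intro huv
  have hodd : ∀ l : ℕ, l.Prime → l ∣ M → Odd l ∧ a + b + 2 ≤ l := fun l hl hlM => by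
    have hl_odd := hM.of_dvd_nat hlM
    have hl_gt := hprime l hl hlM
    refine ⟨hl_odd, ?_⟩
    rw [Nat.odd_iff] at hab hl_odd
    omega
  have hR : IsRigid {z : K | z ^ M = 1} (a + b + 2) (a + b + 1) :=
    isRigid_pow_eq_one le_rfl hM.pos (fun l hl hlM => Or.inr (hodd l hl hlM).2) hζ
  obtain hle | hlong := hR u v hu hv huv (by omega)
  · have hsub : card (v - u) ∈ vanishingLengths {z : K | z ^ M = 1} := by
      refine card_mem_vanishingLengths
        (fun z hz => hv z (mem_of_le (Multiset.sub_le_self v u) hz)) ?_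
      rw [← add_eq_right (b := u.sum), ← sum_add, Multiset.sub_add_cancel hle, huv]
    have hcard := odd_or_two_mul_le_of_mem_closure (b := a + b + 2)
      (fun l hl => hodd l (Nat.prime_of_mem_primeFactors hl) (Nat.dvd_of_mem_primeFactors hl))
      (vanishingLengths_pow_eq_one_le_closure hM.pos hζ hsub)
    rw [card_sub hle, hua, hvb, Nat.odd_iff] at hcard
    omega
  · have hthree : 3 * (a + b + 1) ≤ (a + b + 2 - card u) * (a + b + 1) :=
      Nat.mul_le_mul_right _ (by omega)
    omega

/-- Separating `z ^ M = 1` from `z ^ M = -1` turns the sum into a difference of two sums of `M`-th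
roots of unity. -/
theorem notMem_nullDimensions_two_mul {M d : ℕ} (hM : Odd M) (hd : Odd d)
    (hprime : ∀ l : ℕ, l.Prime → l ∣ M → d < l) : d ∉ nullDimensions (2 * M) := by
  intro hmem
  obtain ⟨s, hs, hs0, rfl⟩ := mem_nullDimensions.1 hmem
  set t := s.filter fun z => z ^ M = 1
  set w := s.filter fun z => ¬z ^ M = 1
  have htw : t + w = s := filter_add_not _ s
  obtain ⟨u, hu, hu_sum, hu_card⟩ := exists_sum_eq_sum_map_add_inv (s := t) (N := M)
    fun z hz => (mem_filter.1 hz).2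
  obtain ⟨v, hv, hv_sum, hv_card⟩ := exists_sum_eq_sum_map_add_inv (s := w.map (-·)) (N := M) <| by
    intro z hz
    obtain ⟨x, hx, rfl⟩ := mem_map.1 hz
    obtain ⟨hxs, hx1⟩ := mem_filter.1 hx
    have hx_neg : x ^ M = -1 := (sq_eq_one_iff.1 (by rw [← pow_mul', hs x hxs])).resolve_left hx1
    rw [hM.neg_pow, hx_neg, neg_neg]
  have huv : u.sum = v.sum := by
    rw [← htw, Multiset.map_add, sum_add] at hs0
    rw [hu_sum, hv_sum, map_map, eq_neg_of_add_eq_zero_left hs0, ← sum_map_neg]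
    exact congrArg sum (map_congr rfl fun z _ => by simp only [Function.comp_apply, inv_neg]; ring)
  rw [card_map] at hv_card
  rw [← htw, card_add] at hd hprime
  have hζ := Complex.isPrimitiveRoot_exp M hM.pos.ne'
  obtain h | h | h := lt_trichotomy (card t) (card w)
  · exact sum_ne_sum_of_card_lt_card hζ hM hd hprime hu hv hu_card hv_card h huv
  · rw [h, Nat.odd_iff] at hd
    omega
  · rw [add_comm] at hd hprime
    exact sum_ne_sum_of_card_lt_card hζ hM hd hprime hv hu hv_card hu_card h huv.symm

theorem mem_nullDimensions_iff_four_dvd {N d : ℕ} (hN : 2 ∣ N) (hd : Odd d)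
    (hprime : ∀ l : ℕ, l.Prime → l ∣ N → l ≠ 2 → d < l) : d ∈ nullDimensions N ↔ 4 ∣ N := by
  refine ⟨fun hmem => ?_, fun h4 => ?_⟩
  · by_contra h4
    obtain ⟨M, rfl⟩ := hN
    have hM : Odd M := Nat.odd_iff.2 (by omega)
    exact notMem_nullDimensions_two_mul hM hd
      (fun l hl hlM => hprime l hl (hlM.mul_left 2) (hM.ne_two_of_dvd_nat hlM)) hmem
  · simpa using (nullDimensions N).nsmul_mem (one_mem_nullDimensions h4) d

end NullDimensions

section PrimeFactorization

theorem coe_primeFactors_prod_pow {ι : Type*} [Fintype ι] {p a : ι → ℕ}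
    (hp : ∀ i, (p i).Prime) (ha : ∀ i, a i ≠ 0) :
    ((∏ i, p i ^ a i).primeFactors : Set ℕ) = Set.range p := by
  ext l
  rw [Finset.mem_coe, Nat.mem_primeFactors_of_ne_zero
    (Finset.prod_ne_zero_iff.2 fun i _ => pow_ne_zero _ (hp i).ne_zero)]
  constructor
  · rintro ⟨hl, hdvd⟩
    obtain ⟨i, -, hi⟩ := hl.prime.exists_mem_finset_dvd hdvd
    exact ⟨i, ((Nat.prime_dvd_prime_iff_eq hl (hp i)).1 (hl.dvd_of_dvd_pow hi)).symm⟩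
  · rintro ⟨i, rfl⟩
    exact ⟨hp i, (dvd_pow_self _ (ha i)).trans
      (Finset.dvd_prod_of_mem (fun i => p i ^ a i) (Finset.mem_univ i))⟩

theorem exists_second_le_of_lt {α : Type*} [Preorder α] {s : ℕ} {p : Fin s → α}
    (hp : StrictMono p) {i j : Fin s} (h : p i < p j) : ∃ h : 1 < s, p ⟨1, h⟩ ≤ p j := by
  have hij : (i : ℕ) < j := hp.lt_iff_lt.1 h
  exact ⟨by omega, hp.monotone (Fin.mk_le_of_le_val (by omega))⟩

end PrimeFactorization

theorem proposition4p1 (d N s : ℕ) [NeZero N] (hd : 1 ≤ d) (hN : 3 ≤ N)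
    (p a : Fin s → ℕ) (hp : ∀ i, (p i).Prime) (hmono : StrictMono p) (ha : ∀ i, 1 ≤ a i)
    (hfact : N = ∏ i, p i ^ a i) :
    -- (i)
    (¬ 2 ∣ N →
      (IsGraphEigenvalue (discreteTorus d N) 0 ↔ ∃ b : Fin s → ℕ, 2 * d = ∑ i, b i * p i)) ∧
    -- (ii)
    (2 ∣ N → Even d → IsGraphEigenvalue (discreteTorus d N) 0) ∧
    -- (iii); `p ⟨1, h⟩` is the second smallest prime factor
    (2 ∣ N → Odd d → (∃ h : 1 < s, p ⟨1, h⟩ ≤ d) →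
      IsGraphEigenvalue (discreteTorus d N) 0) ∧
    -- (iv); the condition on the second prime factor holds if there is none
    (2 ∣ N → Odd d → (∀ h : 1 < s, d < p ⟨1, h⟩) →
      (IsGraphEigenvalue (discreteTorus d N) 0 ↔ 4 ∣ N)) := by
  have hrange : (N.primeFactors : Set ℕ) = Set.range p :=
    hfact ▸ coe_primeFactors_prod_pow hp fun i => Nat.one_le_iff_ne_zero.1 (ha i)
  have hdvd : ∀ i, p i ∣ N := fun i =>
    Nat.dvd_of_mem_primeFactors (Finset.mem_coe.1 (hrange ▸ Set.mem_range_self i))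
  have hexists : ∀ l : ℕ, l.Prime → l ∣ N → ∃ i, p i = l := fun l hl hlN =>
    hrange.subset (Finset.mem_coe.2 (Nat.mem_primeFactors.2 ⟨hl, hlN, NeZero.ne N⟩))
  rw [isGraphEigenvalue_discreteTorus_zero_iff hN]
  refine ⟨fun h2 => ?_, fun h2 hd => ?_, fun h2 hd ⟨hs, hle⟩ => ?_, fun h2 hd hlt => ?_⟩
  · rw [mem_nullDimensions_iff_of_odd (Nat.odd_iff.2 (by omega)), hrange,
      AddSubmonoid.mem_closure_range_iff_of_fintype]
    simp only [smul_eq_mul]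
  · exact even_mem_nullDimensions hd h2
  · have hodd : Odd (p ⟨1, hs⟩) := (hp _).odd_of_ne_two
      ((hp ⟨0, by omega⟩).two_le.trans_lt (hmono Nat.zero_lt_one)).ne'
    exact mem_nullDimensions_of_odd_of_dvd_of_le hd hodd (hp _).ne_one h2 (hdvd _) hle
  · refine mem_nullDimensions_iff_four_dvd h2 hd fun l hl hlN hl2 => ?_
    obtain ⟨i, rfl⟩ := hexists l hl hlN
    obtain ⟨j, hj⟩ := hexists 2 Nat.prime_two h2
    obtain ⟨hs, hle⟩ := exists_second_le_of_lt hmono (hj.trans_lt (hl.two_le.lt_of_ne' hl2))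
    exact (hlt hs).trans_le hle
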